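/- For integers $m,n\ge 1$, the $m\times n$ projective checkerboard $\mathcal{B}_{m,n}$ is the digraph whose vertices (called squares) are the pairs $(p,q)$ of integers with $0\le p\le m-1$ and $0\le q\le n-1$, with a directed edge from each square $\sigma$ to $\sigma E$ and to $\sigma N$, where $$(p,q)E=\begin{cases}(p+1,q)&\text{if }p<m-1,\\(0,n-1-q)&\text{if }p=m-1,\end{cases}\qquad (p,q)N=\begin{cases}(p,q+1)&\text{if }q<n-1,\\(m-1-p,0)&\text{if }q=n-1.\end{cases}$$ A hamiltonian path from $\iota$ to $\tau$ is a directed path in $\mathcal{B}_{m,n}$ that starts at $\iota$, ends at $\tau$ and visits every square exactly once. **Proposition.** Let $m>n\ge 3$ and $\lfloor (m+n)/2\rfloor\le p\le m-1$, and let $(x,y)$ be a square of $\mathcal{B}_{m,n}$. There is a hamiltonian path in $\mathcal{B}_{m,n}$ from $(p,0)$ to $(x,y)$ if and only if one of the following holds: 1. $x+y=m+n-p-2$, $\;m-p+\lfloor (n-1)/2\rfloor\le x\le\lfloor (m-1)/2\rfloor$, and $p\ne (m+n-1)/2$; 2. $x+y=p-1$ and $\lfloor m/2\rfloor\le x\le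 p-\lceil n/2\rceil$; 3. $x=\lfloor (m-1)/2\rfloor$, $y=\lfloor (n-1)/2\rfloor$, and $p=(m+n-1)/2$ (so $m+n$ is odd). -/

import Mathlib

namespace ProjectiveCheckerboard

/-- The squares of the `m × n` checkerboard: pairs `(p, q)` with `0 ≤ p ≤ m - 1`
and `0 ≤ q ≤ n - 1`. -/
abbrev Square (m n : ℕ) : Type := Fin m × Fin n

/-- One step to the east: `(p, q)E = (p + 1, q)` if `p < m - 1`, and
`(p, q)E = (0, n - 1 - q)` if `p = m - 1`. -/
def east {m n : ℕ} (s : Square m n) : Square m n :=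
  if h : s.1.val + 1 < m then (⟨s.1.val + 1, h⟩, s.2)
  else (⟨0, by omega⟩, ⟨n - 1 - s.2.val, by omega⟩)

/-- One step to the north: `(p, q)N = (p, q + 1)` if `q < n - 1`, and
`(p, q)N = (m - 1 - p, 0)` if `q = n - 1`. -/
def north {m n : ℕ} (s : Square m n) : Square m n :=
  if h : s.2.val + 1 < n then (s.1, ⟨s.2.val + 1, h⟩)
  else (⟨m - 1 - s.1.val, by omega⟩, ⟨0, by omega⟩)

/-- The `m × n` projective checkerboard: the digraph on the squares with a directed edge
from `s` to `sE` and from `s` to `sN`, for each square `s`. -/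
def board (m n : ℕ) : Digraph (Square m n) where
  Adj s t := t = east s ∨ t = north s

/-- The list `l` of vertices is a hamiltonian path of the digraph `G` from `a` to `b`:
consecutive vertices are joined by directed edges, every vertex occurs exactly once,
the first vertex is `a` and the last vertex is `b`. -/
structure IsHamiltonianPath {V : Type*} (G : Digraph V) (a b : V) (l : List V) : Prop where
  isChain : l.IsChain G.Adj
  nodup : l.Nodup
  mem : ∀ v, v ∈ l
  head : l.head? = some a
  last : l.getLast? = some b

end ProjectiveCheckerboard

namespace ProjectiveCheckerboard

/-! Call `a + b` the level and `b` the height of `(a, b)`, and call levels `s`, `t` complementary if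
`s + t + 3 = m + n`. An east step and a north step from diagonally adjacent squares of one level
meet in the same square, and the ends of complementary levels meet similarly. So on a hamiltonian
path a pair of complementary levels without the end of the path travels in one direction
(`Trail.flow`). The two possible predecessors of `(p, 0)` lie on level `j = p - 1` and its
complement `i`; they would have to travel in opposite directions, so the end lies on level `i` or
`j`.

Follow the path from level `i` back to itself. Between the terminal levels heights undergo `turn n
r`, where `r` counts the levels travelling north (`Flow.exists_crosses`); beyond level `j` the
effect is a half turn, whatever the directions (`Flow.half_turn`). The return map is thus made of
reflections about two adjacent centres, chosen according to the side of the end's height `k`, plus a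
descent from above. A reflection is an involution, so acyclicity forces `k` into the middle
(`zigzag_center`): `k = (n + r - 1) / 2` on level `j`, `k = (n - 2 - r) / 2` on level `i`. The bound
`r ≤ j - i - 1` (with `r = 0` if `i = j`) becomes the stated range of `x`.

Conversely, let the `r` levels nearest the middle travel north and place the end at that height.
Alternating the reflections moves every height towards `k` (`zigzag_reach`), so joining the end to
the start gives a permutation with a single cycle (`exists_path_of_rule`, `rule_reach`). -/

open Relation

/-! ### Reflections about two adjacent centres -/

/-- A relation without cycles in which each `u` below `N` is related to its mirror image
about one of two adjacent centres, according to the side of `k` on which `u + r` lies, has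
`k` in the middle. -/
theorem zigzag_center {G : ℕ → ℕ → Prop} (htrans : ∀ u v w, G u v → G v w → G u w)
    (hirr : ∀ u, ¬ G u u) {N k r : ℕ} (hN : 1 ≤ N) (hk : k < r + N)
    (hgt : ∀ u < N, k < u + r → G u (N - 1 - u))
    (hlt : ∀ u, u + 1 < N → u + r < k → G u (N - 2 - u)) :
    k = r + (N - 1) / 2 := by
  by_contra hne
  rcases lt_or_gt_of_ne hne with h | h
  -- If `k` is too low, the lowest `u` with `k < u + r` has its mirror image on the same side, so
  -- the reflection takes it back to itself.
  · have h1 := hgt (k + 1 - r) (by omega) (by omega)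
    have h2 := hgt (N - 1 - (k + 1 - r)) (by omega) (by omega)
    rw [show N - 1 - (N - 1 - (k + 1 - r)) = k + 1 - r by omega] at h2
    exact hirr _ (htrans _ _ _ h1 h2)
  -- This point is the mirror image of `k - 1 - r`, the highest one on the lower side.
  · have h1 := hlt (N - 1 + r - k) (by omega) (by omega)
    have h2 := hlt (N - 2 - (N - 1 + r - k)) (by omega) (by omega)
    rw [show N - 2 - (N - 2 - (N - 1 + r - k)) = N - 1 + r - k by omega] at h2
    exact hirr _ (htrans _ _ _ h1 h2)

/-- If `k` is in the middle of `0, …, N - 1` then alternating reflections, preceded by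
a descent from above, lead to `k`. -/
theorem zigzag_reach {G : ℕ → ℕ → Prop} (htrans : ∀ u v w, G u v → G v w → G u w)
    {n N k : ℕ} (hN : 1 ≤ N) (hk : k = (N - 1) / 2)
    (hgt : ∀ u < N, k < u → G u (N - 1 - u))
    (hlt : ∀ u < k, G u (N - 2 - u))
    (htail : ∀ u < n, N ≤ u → G u (u - 1)) :
    ∀ u < n, u = k ∨ G u k := by
  -- `d` bounds the number of reflections left: two of them move a point one place towards `k`. The
  -- parity term accounts for the position of `k = (N - 1) / 2` relative to the two centres.
  have key : ∀ d u, u < N → (u = k ∨ (k < u ∧ 2 * u ≤ 2 * k + d) ∨ (u < k ∧ 2 * k + 2 * ((N + 1) % 2) ≤ 2 * u + d + 1)) →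
      u = k ∨ G u k := by
    intro d
    induction d with
    | zero => intro u hu h; left; omega
    | succ d ih =>
      intro u hu h
      rcases lt_trichotomy u k with huk | huk | huk
      · have h1 := hlt u huk
        rcases ih (N - 2 - u) (by omega) (by omega) with h2 | h2
        · exact Or.inr (h2 ▸ h1)
        · exact Or.inr (htrans _ _ _ h1 h2)
      · exact Or.inl huk
      · have h1 := hgt u hu huk
        rcases ih (N - 1 - u) (by omega) (by omega) with h2 | h2
        · exact Or.inr (h2 ▸ h1)
        · exact Or.inr (htrans _ _ _ h1 h2)
  intro u
  induction u with
  | zero => intro _; exact key (2 * k + 3) 0 hN (by omega)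
  | succ u ih =>
    intro hu
    by_cases h : u + 1 < N
    · exact key (2 * N + 2 * k + 2) _ h (by omega)
    · have h1 := htail _ hu (by omega)
      rcases ih (by omega) with h2 | h2
      · exact Or.inr (h2 ▸ h1)
      · exact Or.inr (htrans _ _ _ h1 h2)

/-! ### The return map on heights -/

/-- The permutation of `0, …, n - 1` that adds `r` where possible and reverses the rest. -/
def turn (n r b : ℕ) : ℕ := if b + r < n then b + r else n - 1 - b

theorem turn_of_lt {n r b : ℕ} (h : b + r < n) : turn n r b = b + r := if_pos h

theorem turn_of_le {n r b : ℕ} (h : n ≤ b + r) : turn n r b = n - 1 - b := if_neg (by omega)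

theorem turn_lt {n r b : ℕ} (h : b < n) : turn n r b < n := by
  unfold turn; split_ifs <;> omega

theorem turn_zero (n b : ℕ) (h : b < n) : turn n 0 b = b := turn_of_lt h

section ReturnMap

variable {G : ℕ → ℕ → Prop} {n k r : ℕ}

/-- Without cycles, a terminal square on the higher level has height `(n + r - 1) / 2`. -/
theorem late_center (htrans : ∀ u v w, G u v → G v w → G u w) (hirr : ∀ u, ¬ G u u)
    (hk : k < n) (hr : r ≤ n)
    (hgt : ∀ u < n, k < turn n r u → G u (n - 1 - turn n r u))
    (hlt : ∀ u < n, turn n r u < k → G u (n - 2 - turn n r u)) :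
    k = (n + r - 1) / 2 := by
  rcases eq_or_lt_of_le hr with rfl | hr
  -- For `r = n` all heights are reversed, and height `0` returns to itself unless `k` is the top
  -- height.
  · by_contra hne
    have ht : turn r r 0 = r - 1 := turn_of_le (by omega)
    have := hgt 0 (by omega) (by omega)
    rw [ht, Nat.sub_self] at this
    exact hirr _ this
  · have := zigzag_center (G := G) htrans hirr (N := n - r) (k := k) (r := r) (by omega) (by omega)
      (fun u hu h => by
        have := hgt u (by omega) (by rw [turn_of_lt (by omega)]; omega)
        rwa [turn_of_lt (by omega), show n - 1 - (u + r) = n - r - 1 - u by omega] at this)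
      (fun u hu h => by
        have := hlt u (by omega) (by rw [turn_of_lt (by omega)]; omega)
        rwa [turn_of_lt (by omega), show n - 2 - (u + r) = n - r - 2 - u by omega] at this)
    omega

theorem late_reach (htrans : ∀ u v w, G u v → G v w → G u w)
    (hn : 1 ≤ n) (hr : r ≤ n) (hk : k = (n + r - 1) / 2)
    (hgt : ∀ u < n, k < turn n r u → G u (n - 1 - turn n r u))
    (hlt : ∀ u < n, turn n r u < k → G u (n - 2 - turn n r u)) :
    ∃ u₀ < n, turn n r u₀ = k ∧ ∀ u < n, u = u₀ ∨ G u u₀ := by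
  -- The heights reversed by `turn` land below `k`; reversal followed by the reflection lowers them
  -- by one.
  have htail : ∀ u < n, n - r ≤ u → 1 ≤ u → G u (u - 1) := by
    intro u hu h h1
    have ht : turn n r u = n - 1 - u := turn_of_le (by omega)
    have := hlt u hu (by omega)
    rwa [ht, show n - 2 - (n - 1 - u) = u - 1 by omega] at this
  rcases eq_or_lt_of_le hr with rfl | hr
  · refine ⟨0, by omega, by rw [turn_of_le (by omega)]; omega, ?_⟩
    exact zigzag_reach htrans (N := 1) le_rfl rfl (fun u hu h => by omega) (fun u hu => by omega)
      (fun u hu h => htail u hu (by omega) h)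
  · refine ⟨k - r, by omega, by rw [turn_of_lt (by omega)]; omega, ?_⟩
    refine zigzag_reach htrans (N := n - r) (by omega) (by omega) ?_ ?_ ?_
    · intro u hu h
      have := hgt u (by omega) (by rw [turn_of_lt (by omega)]; omega)
      rwa [turn_of_lt (by omega), show n - 1 - (u + r) = n - r - 1 - u by omega] at this
    · intro u h
      have := hlt u (by omega) (by rw [turn_of_lt (by omega)]; omega)
      rwa [turn_of_lt (by omega), show n - 2 - (u + r) = n - r - 2 - u by omega] at this
    · intro u hu h
      exact htail u hu h (by omega)

/-- The position in the next column of the square at height `u`, if the squares below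
height `k` travel north and those above it travel east. -/
def lift (k u : ℕ) : ℕ := if u < k then u + 1 else u

/-- Without cycles, a terminal square on the lower level has height `(n - 2 - r) / 2`. -/
theorem early_center (htrans : ∀ u v w, G u v → G v w → G u w) (hirr : ∀ u, ¬ G u u)
    (hr : r + 2 ≤ n) (hk : k < n)
    (hlow : ∀ u < n, u ≠ k → turn n r (lift k u) + 1 < n → G u (n - 2 - turn n r (lift k u)))
    (htop : ∀ u < n, u ≠ k → turn n r (lift k u) + 1 = n → G u (n - 2 - r)) :
    k = (n - 2 - r) / 2 := by
  have hkN : k < n - 1 - r := by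
    by_contra h
    -- If `k` is too high, height `n - 2 - r` is lifted once, crosses to the top of level `j`, and
    -- from there comes back to itself.
    have hl : lift k (n - 2 - r) = n - 1 - r := by unfold lift; rw [if_pos (by omega)]; omega
    refine hirr _ (htop (n - 2 - r) (by omega) (by omega) ?_)
    rw [hl, turn_of_lt (by omega)]; omega
  have := zigzag_center (G := G) htrans hirr (N := n - 1 - r) (k := k) (r := 0) (by omega) (by omega)
      (fun u hu h => by
        have hl : turn n r (lift k u) = u + r := by
          unfold lift; rw [if_neg (by omega), turn_of_lt (by omega)]
        have := hlow u (by omega) (by omega) (by omega)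
        rwa [hl, show n - 2 - (u + r) = n - 1 - r - 1 - u by omega] at this)
      (fun u hu h => by
        have hl : turn n r (lift k u) = u + 1 + r := by
          unfold lift; rw [if_pos (by omega), turn_of_lt (by omega)]
        have := hlow u (by omega) (by omega) (by omega)
        rwa [hl, show n - 2 - (u + 1 + r) = n - 1 - r - 2 - u by omega] at this)
  omega

theorem early_reach (htrans : ∀ u v w, G u v → G v w → G u w)
    (hr : r + 2 ≤ n) (hk : k = (n - 2 - r) / 2)
    (hlow : ∀ u < n, u ≠ k → turn n r (lift k u) + 1 < n → G u (n - 2 - turn n r (lift k u)))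
    (htop : ∀ u < n, u ≠ k → turn n r (lift k u) + 1 = n → G u (n - 2 - r)) :
    ∀ u < n, u = k ∨ G u k := by
  refine zigzag_reach htrans (N := n - 1 - r) (by omega) (by omega) ?_ ?_ ?_
  · intro u hu h
    have hl : turn n r (lift k u) = u + r := by
      unfold lift; rw [if_neg (by omega), turn_of_lt (by omega)]
    have := hlow u (by omega) (by omega) (by omega)
    rwa [hl, show n - 2 - (u + r) = n - 1 - r - 1 - u by omega] at this
  · intro u h
    have hl : turn n r (lift k u) = u + 1 + r := by
      unfold lift; rw [if_pos (by omega), turn_of_lt (by omega)]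
    have := hlow u (by omega) (by omega) (by omega)
    rwa [hl, show n - 2 - (u + 1 + r) = n - 1 - r - 2 - u by omega] at this
  · intro u hu h
    have hl : lift k u = u := by unfold lift; rw [if_neg (by omega)]
    rcases eq_or_lt_of_le h with h | h
    · have := htop u hu (by omega) (by rw [hl, turn_of_lt (by omega)]; omega)
      rwa [show n - 2 - r = u - 1 by omega] at this
    · have ht : turn n r u = n - 1 - u := turn_of_le (by omega)
      have := hlow u hu (by omega) (by rw [hl, ht]; omega)
      rwa [hl, ht, show n - 2 - (n - 1 - u) = u - 1 by omega] at this

end ReturnMap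

/-! ### Flows: the half turn and the crossing between the terminal levels -/

/-- The map `east` on pairs of natural numbers. -/
def eastCoord (m n a b : ℕ) : ℕ × ℕ := if a + 1 < m then (a + 1, b) else (0, n - 1 - b)

/-- The map `north` on pairs of natural numbers. -/
def northCoord (m n a b : ℕ) : ℕ × ℕ := if b + 1 < n then (a, b + 1) else (m - 1 - a, 0)

/-- Outside the levels `i` and `j` of `a + b`, the relation `R` contains the steps from
`(a, b)` to the east if `e (a + b)` holds and to the north otherwise, and `e` agrees on
complementary levels. -/
structure Flow (m n i j : ℕ) (e : ℕ → Prop) (R : ℕ × ℕ → ℕ × ℕ → Prop) : Prop where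
  east : ∀ a b, a < m → b < n → a + b ≠ i → a + b ≠ j → e (a + b) → R (a, b) (eastCoord m n a b)
  north : ∀ a b, a < m → b < n → a + b ≠ i → a + b ≠ j → ¬ e (a + b) →
    R (a, b) (northCoord m n a b)
  symm : ∀ s t, s + t + 3 = m + n → s ≠ i → s ≠ j → (e s ↔ e t)

/-- The relation `R` leads from level `s` to level `t`, with `turn n r` acting on heights. -/
def Crosses (n s t r : ℕ) (R : ℕ × ℕ → ℕ × ℕ → Prop) : Prop :=
  ∀ b < n, ReflTransGen R (s - b, b) (t - turn n r b, turn n r b)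

theorem eastCoord_of_lt {m n a b : ℕ} (h : a + 1 < m) : eastCoord m n a b = (a + 1, b) := if_pos h

theorem eastCoord_of_eq {m n a b : ℕ} (h : a + 1 = m) : eastCoord m n a b = (0, n - 1 - b) :=
  if_neg (by omega)

theorem northCoord_of_lt {m n a b : ℕ} (h : b + 1 < n) : northCoord m n a b = (a, b + 1) := if_pos h

theorem northCoord_of_eq {m n a b : ℕ} (h : b + 1 = n) : northCoord m n a b = (m - 1 - a, 0) :=
  if_neg (by omega)

variable {m n i j : ℕ} {e : ℕ → Prop} {R : ℕ × ℕ → ℕ × ℕ → Prop}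

namespace Flow

theorem east_step (h : Flow m n i j e R) {a b a' b' : ℕ} (ha : a < m) (hb : b < n)
    (hi : a + b ≠ i) (hj : a + b ≠ j) (he : e (a + b))
    (ha' : a' = if a + 1 < m then a + 1 else 0) (hb' : b' = if a + 1 < m then b else n - 1 - b) :
    R (a, b) (a', b') := by
  have := h.east a b ha hb hi hj he
  unfold eastCoord at this
  split_ifs at * <;> subst ha' hb' <;> exact this

theorem north_step (h : Flow m n i j e R) {a b a' b' : ℕ} (ha : a < m) (hb : b < n)
    (hi : a + b ≠ i) (hj : a + b ≠ j) (he : ¬ e (a + b))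
    (ha' : a' = if b + 1 < n then a else m - 1 - a) (hb' : b' = if b + 1 < n then b + 1 else 0) :
    R (a, b) (a', b') := by
  have := h.north a b ha hb hi hj he
  unfold northCoord at this
  split_ifs at * <;> subst ha' hb' <;> exact this

/-- From the levels beyond the terminal ones, every square is carried to its image under the
half turn of the board. -/
theorem half_turn (h : Flow m n i j e R) (hij : i + j + 3 = m + n) (hle : i ≤ j) :
    ∀ s ≤ i, ∀ a b, a < m → b < n → a + b + s + 2 = m + n →
      TransGen R (a, b) (m - 1 - a, n - 1 - b) := by
  intro s
  induction s with
  | zero =>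
    intro _ a b ha hb hab
    -- Both directions take the corner `(m - 1, n - 1)` to `(0, 0)`.
    by_cases he : e (a + b)
    · exact .single (h.east_step ha hb (by omega) (by omega) he (by split_ifs <;> omega)
        (by split_ifs <;> omega))
    · exact .single (h.north_step ha hb (by omega) (by omega) he (by split_ifs <;> omega)
        (by split_ifs <;> omega))
  | succ s ih =>
    intro hs a b ha hb hab
    have hsym := h.symm s (a + b) (by omega) (by omega) (by omega)
    by_cases he : e s
    -- The half turn reverses displacements: a step east, the half turn from the next level, and a
    -- step east on the complementary level combine to the half turn of `(a, b)`. At the edge the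
    -- wrap-around is itself the half turn.
    · by_cases ham : a + 1 < m
      · refine .head (b := (a + 1, b)) (h.east_step ha hb (by omega) (by omega) (hsym.1 he)
          (by rw [if_pos ham]) (by rw [if_pos ham])) ?_
        refine .tail (ih (by omega) (a + 1) b ham hb (by omega)) ?_
        have hl : m - 1 - (a + 1) + (n - 1 - b) = s := by omega
        exact h.east_step (by omega) (by omega) (by omega) (by omega) (hl ▸ he)
          (by split_ifs <;> omega) (by split_ifs <;> omega)
      · exact .single (h.east_step ha hb (by omega) (by omega) (hsym.1 he)
          (by split_ifs; omega) (by split_ifs; omega))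
    · by_cases hbn : b + 1 < n
      · refine .head (b := (a, b + 1)) (h.north_step ha hb (by omega) (by omega)
          (fun h' => he (hsym.2 h')) (by rw [if_pos hbn]) (by rw [if_pos hbn])) ?_
        refine .tail (ih (by omega) a (b + 1) ha hbn (by omega)) ?_
        have hl : m - 1 - a + (n - 1 - (b + 1)) = s := by omega
        exact h.north_step (by omega) (by omega) (by omega) (by omega) (hl ▸ he)
          (by split_ifs <;> omega) (by split_ifs <;> omega)
      · exact .single (h.north_step ha hb (by omega) (by omega)
          (fun h' => he (hsym.2 h')) (by split_ifs; omega) (by split_ifs; omega))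

end Flow

theorem Crosses.refl (s : ℕ) : Crosses n s s 0 R := fun b hb => by
  rw [turn_zero n b hb]

namespace Flow

theorem crosses_middle_east (h : Flow m n i j e R) {s : ℕ} (hs : s + s + 3 = m + n)
    (hi : i < s) (hj : s < j) (hni : n ≤ i + 1) (he : e s) :
    Crosses n s (s + 1) 0 R := fun b hb => by
  rw [turn_zero n b hb]
  have hl : s - b + b = s := by omega
  exact .single (h.east_step (by omega) hb (by omega) (by omega) (hl.symm ▸ he)
    (by split_ifs <;> omega) (by split_ifs <;> omega))

theorem crosses_middle_north (h : Flow m n i j e R) {s : ℕ} (hs : s + s + 3 = m + n)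
    (hi : i < s) (hj : s < j) (hni : n ≤ i + 1) (he : ¬ e s) :
    Crosses n s (s + 1) 1 R := fun b hb => by
  have hl : s - b + b = s := by omega
  refine .single (h.north_step (by omega) hb (by omega) (by omega) (hl.symm ▸ he) ?_ ?_) <;>
  unfold turn <;> split_ifs <;> omega

theorem crosses_east (h : Flow m n i j e R) {s t r : ℕ} (hst : s + t + 3 = m + n)
    (hi : i < s) (hlt : s < t) (hj : t < j) (hni : n ≤ i + 1) (hjm : j < m) (he : e s)
    (hc : Crosses n (s + 1) t r R) : Crosses n s (t + 1) r R := fun b hb => by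
  have hl : s - b + b = s := by omega
  have ht := turn_lt (r := r) hb
  have hl' : t - turn n r b + turn n r b = t := by omega
  refine .head (b := (s + 1 - b, b)) (h.east_step (by omega) hb (by omega) (by omega)
    (hl.symm ▸ he) (by split_ifs <;> omega) (by split_ifs <;> omega)) (.tail (hc b hb) ?_)
  exact h.east_step (by omega) ht (by omega) (by omega)
    (hl'.symm ▸ (h.symm s t hst (by omega) (by omega)).1 he)
    (by split_ifs <;> omega) (by split_ifs <;> omega)

/-- A north step before and one after the crossing add `2` to the shift. The wrap-around supplies
the reversal for the heights that no longer fit. -/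
theorem crosses_north (h : Flow m n i j e R) {s t r : ℕ} (hst : s + t + 3 = m + n)
    (hi : i < s) (hlt : s < t) (hj : t < j) (hni : n ≤ i + 1) (hjm : j < m) (he : ¬ e s)
    (hr : r + 2 ≤ n) (hc : Crosses n (s + 1) t r R) : Crosses n s (t + 1) (r + 2) R := by
  have he' : ¬ e t := fun h' => he ((h.symm s t hst (by omega) (by omega)).2 h')
  have hfst : ∀ b < n, ∀ a' b', (a' = if b + 1 < n then s - b else m - 1 - (s - b)) →
      (b' = if b + 1 < n then b + 1 else 0) → R (s - b, b) (a', b') := fun b hb a' b' ha' hb' => by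
    have hl : s - b + b = s := by omega
    exact h.north_step (by omega) hb (by omega) (by omega) (hl.symm ▸ he) ha' hb'
  have hsnd : ∀ b < n, ∀ a' b', (a' = if b + 1 < n then t - b else m - 1 - (t - b)) →
      (b' = if b + 1 < n then b + 1 else 0) → R (t - b, b) (a', b') := fun b hb a' b' ha' hb' => by
    have hl : t - b + b = t := by omega
    exact h.north_step (by omega) hb (by omega) (by omega) (hl.symm ▸ he') ha' hb'
  intro b hb
  rcases Nat.lt_or_ge (b + 1) n with hbn | hbn
  · refine .head (b := (s + 1 - (b + 1), b + 1)) (hfst b hb _ _ (by split_ifs; omega)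
      (by split_ifs; omega)) (.trans (hc (b + 1) hbn) ?_)
    have ht := turn_lt (r := r) hbn
    rcases Nat.lt_or_ge (turn n r (b + 1) + 1) n with htn | htn
    · refine .single (hsnd _ ht _ _ ?_ ?_) <;> rw [if_pos htn] <;> unfold turn at * <;>
      split_ifs at * <;> omega
    -- Here `b + r + 2 = n`. The top square of level `t` wraps back to `(s + 1, 0)`; a second
    -- crossing ends at height `r`, and one more step north gives `r + 1 = n - 1 - b`.
    · refine .head (b := (s + 1 - 0, 0)) (hsnd _ ht _ _ (by split_ifs <;> omega)
        (by split_ifs <;> omega)) (.trans (hc 0 (by omega)) (.single ?_))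
      rw [turn_of_lt (b := 0) (by omega)]
      refine hsnd _ (by omega) _ _ ?_ ?_ <;> rw [if_pos (by omega)] <;> unfold turn at * <;>
      split_ifs at * <;> omega
  · refine .single (hfst b hb _ _ ?_ ?_) <;> rw [if_neg (by omega)] <;> unfold turn <;>
      split_ifs <;> omega

/-- If `n - 1 ≤ r` then a further pair of levels travelling north closes a cycle. -/
theorem cycle_of_crosses_north (h : Flow m n i j e R) {s t r : ℕ} (hst : s + t + 3 = m + n)
    (hi : i < s) (hlt : s < t) (hj : t < j) (hni : n ≤ i + 1) (he : ¬ e s)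
    (hn : 1 ≤ n) (hr : n ≤ r + 1) (hrn : r ≤ n) (hc : Crosses n (s + 1) t r R) :
    TransGen R (t - (n - 1), n - 1) (t - (n - 1), n - 1) := by
  have he' : ¬ e t := fun h' => he ((h.symm s t hst (by omega) (by omega)).2 h')
  have hl : t - (n - 1) + (n - 1) = t := by omega
  have h0 : turn n r 0 = n - 1 := by unfold turn; split_ifs <;> omega
  have := hc 0 (by omega)
  rw [h0] at this
  exact .trans_left (.single (h.north_step (by omega) (by omega) (by omega) (by omega)
    (hl.symm ▸ he') (a' := s + 1 - 0) (by split_ifs <;> omega)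
    (by split_ifs <;> omega))) this

/-- Between the terminal levels, the relation acts by some `turn`. -/
theorem exists_crosses (h : Flow m n i j e R) (hcyc : ∀ v, ¬ TransGen R v v)
    (hn : 1 ≤ n) (hni : n ≤ i + 1) (hjm : j < m) :
    ∀ w s t, w + s = t → s + t + 2 = m + n → i < s → t ≤ j →
      ∃ r, r ≤ n ∧ r ≤ w ∧ Crosses n s t r R := by
  intro w
  induction w using Nat.strong_induction_on with
  | _ w ih =>
  intro s t hw hst hi hj
  rcases Nat.lt_or_ge w 2 with h2 | h2
  · rcases Nat.lt_or_ge w 1 with h1 | h1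
    · obtain rfl : s = t := by omega
      exact ⟨0, by omega, by omega, Crosses.refl s⟩
    · obtain rfl : t = s + 1 := by omega
      by_cases he : e s
      · exact ⟨0, by omega, by omega,
          h.crosses_middle_east (by omega) hi (by omega) hni he⟩
      · exact ⟨1, by omega, by omega,
          h.crosses_middle_north (by omega) hi (by omega) hni he⟩
  · obtain ⟨t, rfl⟩ : ∃ t', t = t' + 1 := ⟨t - 1, by omega⟩
    obtain ⟨r, hrn, hrw, hc⟩ := ih (w - 2) (by omega) (s + 1) t (by omega) (by omega) (by omega)
      (by omega)
    by_cases he : e s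
    · exact ⟨r, hrn, by omega,
        h.crosses_east (by omega) hi (by omega) (by omega) hni hjm he hc⟩
    · rcases Nat.lt_or_ge n (r + 2) with hr | hr
      · exact absurd (h.cycle_of_crosses_north (by omega) hi (by omega) (by omega) hni he hn
          (by omega) hrn hc) (hcyc _)
      · exact ⟨r + 2, by omega, by omega,
          h.crosses_north (by omega) hi (by omega) (by omega) hni hjm he hr hc⟩

end Flow

/-! ### Return to level `i` -/

/-- Return to level `i` from a terminal square at level `j`. -/
theorem late_return {k r : ℕ} (hij : i + j + 3 = m + n) (hni : n ≤ i + 1)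
    (hturn : ∀ a b, a < m → b < n → a + b + i + 2 = m + n →
      TransGen R (a, b) (m - 1 - a, n - 1 - b))
    (hjm : j + 1 < m)
    (hc : Crosses n i j r R)
    (hgt : ∀ c < n, k < c → R (j - c, c) (j + 1 - c, c))
    (hlt : ∀ c < k, R (j - c, c) (j - c, c + 1)) (hk : k < n) (hle : i ≤ j) :
    (∀ u < n, k < turn n r u →
      TransGen R (i - u, u) (i - (n - 1 - turn n r u), n - 1 - turn n r u)) ∧
    (∀ u < n, turn n r u < k →
      TransGen R (i - u, u) (i - (n - 2 - turn n r u), n - 2 - turn n r u)) := by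
  constructor
  · intro u hu h
    have ht := turn_lt (r := r) hu
    have h1 := hturn (j + 1 - turn n r u) (turn n r u) (by omega) ht (by omega)
    rw [show m - 1 - (j + 1 - turn n r u) = i - (n - 1 - turn n r u) by omega] at h1
    exact .trans_right (hc u hu) (.head (hgt _ ht h) h1)
  · intro u hu h
    have ht := turn_lt (r := r) hu
    have h1 := hturn (j - turn n r u) (turn n r u + 1) (by omega) (by omega) (by omega)
    rw [show m - 1 - (j - turn n r u) = i - (n - 2 - turn n r u) by omega,
      show n - 1 - (turn n r u + 1) = n - 2 - turn n r u by omega] at h1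
    exact .trans_right (hc u hu) (.head (hlt _ h) h1)

/-- Return to level `i` from level `j` if the terminal square is at level `i`. -/
theorem early_return {k r : ℕ} (hij : i + j + 3 = m + n) (hni : n ≤ i + 1)
    (hturn : ∀ a b, a < m → b < n → a + b + i + 2 = m + n →
      TransGen R (a, b) (m - 1 - a, n - 1 - b))
    (hjm : j + 1 < m) (hlt : i < j)
    (hc : Crosses n (i + 1) j r R)
    (hgt : ∀ c < n, k < c → R (i - c, c) (i + 1 - c, c))
    (hlow : ∀ c < k, R (i - c, c) (i - c, c + 1)) (hk : k < n)
    (hj : ∀ c, c + 1 < n → R (j - c, c) (j - c, c + 1))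
    (hjtop : R (j - (n - 1), n - 1) (i + 1, 0)) :
    (r ≤ n → n < r + 2 → TransGen R (j - (n - 1), n - 1) (j - (n - 1), n - 1)) ∧
    (∀ u < n, u ≠ k → turn n r (lift k u) + 1 < n →
      TransGen R (i - u, u) (i - (n - 2 - turn n r (lift k u)), n - 2 - turn n r (lift k u))) ∧
    (r + 2 ≤ n → ∀ u < n, u ≠ k → turn n r (lift k u) + 1 = n →
      TransGen R (i - u, u) (i - (n - 2 - r), n - 2 - r)) := by
  have hup : ∀ c, c + 1 < n → TransGen R (j - c, c) (i - (n - 2 - c), n - 2 - c) := by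
    intro c hcn
    have h1 := hturn (j - c) (c + 1) (by omega) (by omega) (by omega)
    rw [show m - 1 - (j - c) = i - (n - 2 - c) by omega,
      show n - 1 - (c + 1) = n - 2 - c by omega] at h1
    exact .head (hj c hcn) h1
  have hlift : ∀ u < n, u ≠ k → lift k u < n ∧ R (i - u, u) (i + 1 - lift k u, lift k u) := by
    intro u hu huk
    unfold lift
    split_ifs with h
    · rw [show i + 1 - (u + 1) = i - u by omega]
      exact ⟨by omega, hlow u h⟩
    · exact ⟨hu, hgt u hu (by omega)⟩
  refine ⟨?_, ?_, ?_⟩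
  · intro hrn hr
    have h0 : turn n r 0 = n - 1 := by unfold turn; split_ifs <;> omega
    have := hc 0 (by omega)
    rw [h0] at this
    exact .trans_left (.single hjtop) this
  · intro u hu huk h
    obtain ⟨h1, h2⟩ := hlift u hu huk
    exact .head h2 (.trans_right (hc _ h1) (hup _ h))
  · intro hr u hu huk h
    obtain ⟨h1, h2⟩ := hlift u hu huk
    have h3 := hc _ h1
    rw [show turn n r (lift k u) = n - 1 by omega] at h3
    have h4 := hc 0 (by omega)
    rw [turn_of_lt (b := 0) (by omega), Nat.zero_add] at h4
    exact .head h2 (.trans_right h3 (.head hjtop (.trans_right h4 (hup r (by omega)))))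

/-! ### Necessity: where a path can end -/

/-- The successor relation of a hamiltonian path from `(p, 0)` to `(x, y)`, in coordinates. -/
structure Trail (m n p x y : ℕ) (R : ℕ × ℕ → ℕ × ℕ → Prop) : Prop where
  go : ∀ a b, a < m → b < n → ¬ (a = x ∧ b = y) →
    R (a, b) (eastCoord m n a b) ∨ R (a, b) (northCoord m n a b)
  inj : ∀ u v w, R u w → R v w → u = v
  start : ∀ u, ¬ R u (p, 0)
  acyclic : ∀ v, ¬ TransGen R v v

namespace Trail

variable {m n p x y : ℕ} {R : ℕ × ℕ → ℕ × ℕ → Prop}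

theorem east_of_eq (h : Trail m n p x y R) {a b a' b' : ℕ} (ha : a' < m) (hb : b' < n)
    (he : R (a, b) (eastCoord m n a b)) (heq : eastCoord m n a b = northCoord m n a' b')
    (hne : ¬ (a' = x ∧ b' = y)) : R (a', b') (eastCoord m n a' b') := by
  rcases h.go a' b' ha hb hne with h1 | h1
  · exact h1
  · have h2 := h.inj _ _ _ he (heq ▸ h1)
    simp only [Prod.mk.injEq] at h2
    rw [← h2.1, ← h2.2]
    exact he

/-- Along a level, the property of travelling east propagates downwards until the end of the
path. -/
theorem east_down (h : Trail m n p x y R) {a' b' : ℕ} (ha : a' < m) :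
    ∀ c a b, b = b' + c → a' = a + c → b < n → R (a, b) (eastCoord m n a b) →
      ¬ (x + y = a + b ∧ b' ≤ y ∧ y < b) → R (a', b') (eastCoord m n a' b') := by
  intro c
  induction c with
  | zero => rintro a b rfl rfl _ he _; exact he
  | succ c ih =>
    intro a b hb ha' hbn he hne
    refine ih (a + 1) (b - 1) (by omega) (by omega) (by omega) ?_ (by omega)
    refine h.east_of_eq (by omega) (by omega) he ?_ (by omega)
    rw [eastCoord_of_lt (by omega), northCoord_of_lt (by omega), Nat.sub_add_cancel (by omega)]

/-- The property of travelling east passes from a level to the complementary one. -/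
theorem east_across (h : Trail m n p x y R) {s t a b a' b' : ℕ} (hst : s + t + 3 = m + n)
    (ha : a < m) (hb : b < n) (hab : a + b = s) (ha' : a' < m) (hb' : b' < n) (hab' : a' + b' = t)
    (he : R (a, b) (eastCoord m n a b)) (hs : ¬ (x + y = s ∧ y < b))
    (ht : ¬ (x + y = t ∧ b' ≤ y)) : R (a', b') (eastCoord m n a' b') := by
  -- The lower end of level `s` lies on the south edge or on the east edge; its east step meets the
  -- north step from the upper end of level `t`.
  rcases Nat.lt_or_ge (s + 1) m with hsm | hsm
  · have h1 := h.east_down (a' := s) (b' := 0) (by omega) b a b (by omega) (by omega) hb he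
      (by omega)
    have h2 := h.east_of_eq (a' := m - 2 - s) (b' := n - 1) (by omega) (by omega) h1
      (by rw [eastCoord_of_lt hsm, northCoord_of_eq (by omega), Prod.mk.injEq]; omega) (by omega)
    exact h.east_down ha' (n - 1 - b') _ _ (by omega) (by omega) (by omega) h2 (by omega)
  · have h1 := h.east_down (a' := m - 1) (b' := s + 1 - m) (by omega) (b - (s + 1 - m)) a b
      (by omega) (by omega) hb he (by omega)
    have h2 := h.east_of_eq (a' := 0) (b' := t) (by omega) (by omega) h1
      (by rw [eastCoord_of_eq (by omega), northCoord_of_lt (by omega), Prod.mk.injEq]; omega)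
      (by omega)
    exact h.east_down ha' (t - b') _ _ (by omega) (by omega) (by omega) h2 (by omega)

/-- The levels whose squares travel east. -/
def EastLevel (m n : ℕ) (R : ℕ × ℕ → ℕ × ℕ → Prop) (s : ℕ) : Prop :=
  ∃ a b, a < m ∧ b < n ∧ a + b = s ∧ R (a, b) (eastCoord m n a b)

/-- Travelling east spreads only downwards along a level, but passing to the complementary level and
back reaches all of it. -/
theorem flow (h : Trail m n p x y R) {i j : ℕ} (hij : i + j + 3 = m + n)
    (hm : 2 ≤ m) (hn : 2 ≤ n) (hxy : x + y = i ∨ x + y = j) :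
    Flow m n i j (EastLevel m n R) R where
  east a b ha hb hi hj he := by
    obtain ⟨a', b', ha', hb', hab, he⟩ := he
    rcases Nat.lt_or_ge (a + b + 2) (m + n) with hlt | hge
    · obtain ⟨t, ht⟩ : ∃ t, a + b + t + 3 = m + n := ⟨m + n - 3 - (a + b), by omega⟩
      have h1 := h.east_across (a' := t - (n - 1)) (b' := t - (t - (n - 1))) ht ha' hb' hab
        (by omega) (by omega) (by omega) he (by omega) (by omega)
      exact h.east_across (s := t) (t := a + b) (by omega) (by omega) (by omega) (by omega)
        ha hb rfl h1 (by omega) (by omega)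
    · obtain rfl : a = a' := by omega
      obtain rfl : b = b' := by omega
      exact he
  north a b ha hb hi hj he :=
    (h.go a b ha hb (by omega)).resolve_left fun h' => he ⟨a, b, ha, hb, rfl, h'⟩
  symm := by
    have key : ∀ s t, s + t + 3 = m + n → s ≠ i → s ≠ j → EastLevel m n R s →
        EastLevel m n R t := by
      rintro s t hst hi hj ⟨a, b, ha, hb, hab, he⟩
      exact ⟨t - (n - 1), t - (t - (n - 1)), by omega, by omega, by omega,
        h.east_across hst ha hb hab (by omega) (by omega) (by omega) he (by omega) (by omega)⟩
    exact fun s t hst hi hj => ⟨key s t hst hi hj, key t s (by omega) (by omega) (by omega)⟩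

/-- The possible ends of a hamiltonian path from `(p, 0)`. -/
theorem terminal (h : Trail m n p x y R) (hn : 3 ≤ n) (hmn : n < m)
    (hp : (m + n) / 2 ≤ p) (hpm : p ≤ m - 1) (hx : x < m) (hy : y < n) :
    ((x + y = m + n - p - 2 ∧
        m - p + (n - 1) / 2 ≤ x ∧ x ≤ (m - 1) / 2 ∧ 2 * p ≠ m + n - 1) ∨
      (x + y = p - 1 ∧ m / 2 ≤ x ∧ x ≤ p - (n + 1) / 2) ∨
      (x = (m - 1) / 2 ∧ y = (n - 1) / 2 ∧ 2 * p = m + n - 1)) := by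
  obtain ⟨j, rfl⟩ : ∃ j, p = j + 1 := ⟨p - 1, by omega⟩
  obtain ⟨i, hij⟩ : ∃ i, i + j + 3 = m + n := ⟨m + n - 3 - j, by omega⟩
  have hle : i ≤ j := by omega
  have hni : n ≤ i + 1 := by omega
  have hjm : j + 1 < m := by omega
  have hEi : ∀ a b, a < m → b < n → a + b = i → ¬ (x + y = i ∧ b ≤ y) →
      R (a, b) (eastCoord m n a b) := by
    intro a b ha hb hab hne
    -- A north step from the upper end of level `i` would enter the start.
    have h1 : R (i - (n - 1), n - 1) (eastCoord m n (i - (n - 1)) (n - 1)) := by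
      refine (h.go _ _ (by omega) (by omega) (by omega)).resolve_right fun h' => ?_
      rw [northCoord_of_eq (by omega), show m - 1 - (i - (n - 1)) = j + 1 by omega] at h'
      exact h.start _ h'
    exact h.east_down ha (n - 1 - b) _ _ (by omega) (by omega) (by omega) h1 (by omega)
  have hbot : ¬ R (j, 0) (eastCoord m n j 0) := by
    rw [eastCoord_of_lt hjm]; exact h.start _
  have hNj : ∀ a b, a < m → b < n → a + b = j → ¬ (x + y = j ∧ y ≤ b) →
      R (a, b) (northCoord m n a b) := by
    intro a b ha hb hab hne
    refine (h.go _ _ ha hb (by omega)).resolve_left fun h' => hbot ?_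
    exact h.east_down (by omega) b _ _ (by omega) (by omega) hb h' (by omega)
  -- Otherwise the east direction of level `i` passes to level `j`, and `(j, 0)` steps into the
  -- start.
  have hxy : x + y = i ∨ x + y = j := by
    by_contra hne
    exact hbot (h.east_across hij (by omega) (by omega) (Nat.add_zero i) (by omega) (by omega)
      (Nat.add_zero j) (hEi i 0 (by omega) (by omega) rfl (by omega)) (by omega) (by omega))
  have hF := h.flow hij (by omega) (by omega) hxy
  have hturn := hF.half_turn hij hle i le_rfl
  have htrans : ∀ u v w, TransGen R (i - u, u) (i - v, v) → TransGen R (i - v, v) (i - w, w) →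
      TransGen R (i - u, u) (i - w, w) := fun u v w => TransGen.trans
  by_cases hj : x + y = j
  · -- the end lies on the higher terminal level
    have hEj : ∀ c < n, y < c → R (j - c, c) (j + 1 - c, c) := by
      intro c hc hyc
      have h1 : R (j - c, c) (eastCoord m n (j - c) c) := by
        rcases eq_or_lt_of_le hle with rfl | hlt
        · exact hEi _ _ (by omega) hc (by omega) (by omega)
        · exact h.east_across hij (by omega) (by omega) (Nat.add_zero i) (by omega) hc
            (by omega) (hEi i 0 (by omega) (by omega) rfl (by omega)) (by omega) (by omega)
      rwa [eastCoord_of_lt (by omega), show j - c + 1 = j + 1 - c by omega] at h1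
    have hNj' : ∀ c < y, R (j - c, c) (j - c, c + 1) := by
      intro c hc
      have h1 := hNj (j - c) c (by omega) (by omega) (by omega) (by omega)
      rwa [northCoord_of_lt (by omega)] at h1
    obtain ⟨r, hrn, hrw, hc⟩ : ∃ r, r ≤ n ∧ (r = 0 ∨ r + i + 1 ≤ j) ∧ Crosses n i j r R := by
      rcases eq_or_lt_of_le hle with rfl | hlt
      · exact ⟨0, by omega, by omega, Crosses.refl i⟩
      · obtain ⟨r, hrn, hrw, hc⟩ := hF.exists_crosses h.acyclic (by omega) hni (by omega)
          (j - (i + 1)) (i + 1) j (by omega) (by omega) (by omega) le_rfl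
        refine ⟨r, hrn, by omega, fun b hb => .head ?_ (hc b hb)⟩
        have h1 := hEi (i - b) b (by omega) hb (by omega) (by omega)
        rwa [eastCoord_of_lt (by omega), show i - b + 1 = i + 1 - b by omega] at h1
    obtain ⟨h1, h2⟩ := late_return hij hni hturn hjm hc hEj hNj' hy hle
    have := late_center (G := fun u v => TransGen R (i - u, u) (i - v, v)) htrans
      (fun u => h.acyclic _) hy hrn h1 h2
    omega
  · -- the end lies on the lower terminal level
    have hlt : i < j := by omega
    have hgt : ∀ c < n, y < c → R (i - c, c) (i + 1 - c, c) := by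
      intro c hc hyc
      have h1 := hEi (i - c) c (by omega) hc (by omega) (by omega)
      rwa [eastCoord_of_lt (by omega), show i - c + 1 = i + 1 - c by omega] at h1
    have hlow : ∀ c < y, R (i - c, c) (i - c, c + 1) := by
      intro c hc
      have h1 : R (i - c, c) (northCoord m n (i - c) c) := by
        refine (h.go _ _ (by omega) (by omega) (by omega)).resolve_left fun h' => hbot ?_
        exact h.east_across hij (by omega) (by omega) (by omega) (by omega) (by omega)
          (Nat.add_zero j) h' (by omega) (by omega)
      rwa [northCoord_of_lt (by omega)] at h1
    have hj' : ∀ c, c + 1 < n → R (j - c, c) (j - c, c + 1) := by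
      intro c hc
      have h1 := hNj (j - c) c (by omega) (by omega) (by omega) (by omega)
      rwa [northCoord_of_lt (by omega)] at h1
    have hjtop : R (j - (n - 1), n - 1) (i + 1, 0) := by
      have h1 := hNj (j - (n - 1)) (n - 1) (by omega) (by omega) (by omega) (by omega)
      rwa [northCoord_of_eq (by omega), show m - 1 - (j - (n - 1)) = i + 1 by omega] at h1
    obtain ⟨r, hrn, hrw, hc⟩ := hF.exists_crosses h.acyclic (by omega) hni (by omega)
      (j - (i + 1)) (i + 1) j (by omega) (by omega) (by omega) le_rfl
    obtain ⟨h0, h1, h2⟩ := early_return hij hni hturn hjm hlt hc hgt hlow hy hj' hjtop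
    have hr : r + 2 ≤ n := by
      by_contra hr
      exact h.acyclic _ (h0 hrn (by omega))
    have := early_center (G := fun u v => TransGen R (i - u, u) (i - v, v)) htrans
      (fun u => h.acyclic _) hr hy h1 (h2 hr)
    omega

end Trail

/-- The successor relation along a hamiltonian path, in coordinates. -/
theorem IsHamiltonianPath.trail {m n p : ℕ} {hp : p < m} {hn : 0 < n} {x : Fin m} {y : Fin n}
    {l : List (Square m n)} (h : IsHamiltonianPath (board m n) (⟨p, hp⟩, ⟨0, hn⟩) (x, y) l) :
    Trail m n p x y (fun u v => ∃ s t : Square m n, u = (s.1.val, s.2.val) ∧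
      v = (t.1.val, t.2.val) ∧ l.idxOf t = l.idxOf s + 1) where
  go a b ha hb hne := by
    set s : Square m n := (⟨a, ha⟩, ⟨b, hb⟩) with hs
    have hidx : l.idxOf s < l.length := List.idxOf_lt_length_of_mem (h.mem s)
    have hlast : l.idxOf s + 1 < l.length := by
      by_contra hge
      have h1 := h.last
      rw [List.getLast?_eq_getElem?, show l.length - 1 = l.idxOf s by omega,
        List.getElem?_eq_getElem hidx, List.getElem_idxOf, Option.some.injEq] at h1
      rw [hs, Prod.mk.injEq] at h1
      exact hne ⟨congrArg Fin.val h1.1, congrArg Fin.val h1.2⟩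
    have hadj := List.isChain_iff_getElem.1 h.isChain (l.idxOf s) hlast
    rw [List.getElem_idxOf] at hadj
    have hidx' : l.idxOf l[l.idxOf s + 1] = l.idxOf s + 1 := h.nodup.idxOf_getElem _ _
    rcases hadj with hadj | hadj
    · refine Or.inl ⟨s, l[l.idxOf s + 1], rfl, ?_, hidx'⟩
      rw [hadj]
      unfold eastCoord east
      split_ifs <;> rfl
    · refine Or.inr ⟨s, l[l.idxOf s + 1], rfl, ?_, hidx'⟩
      rw [hadj]
      unfold northCoord north
      split_ifs <;> rfl
  inj := by
    rintro _ _ _ ⟨s, t, rfl, rfl, hst⟩ ⟨s', t', rfl, htt, hst'⟩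
    have ht : t = t' := by
      simp only [Prod.mk.injEq] at htt
      exact Prod.ext (Fin.ext htt.1) (Fin.ext htt.2)
    subst ht
    have : s = s' := (List.idxOf_inj (h.mem s)).1 (by omega)
    rw [this]
  start := by
    rintro _ ⟨s, t, rfl, ht, hst⟩
    have ht : t = (⟨p, hp⟩, ⟨0, hn⟩) := by
      simp only [Prod.mk.injEq] at ht
      exact Prod.ext (Fin.ext ht.1.symm) (Fin.ext ht.2.symm)
    obtain ⟨l', rfl⟩ := List.head?_eq_some_iff.1 h.head
    rw [ht, List.idxOf_cons_self] at hst
    omega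
  acyclic := by
    have key : ∀ u v, TransGen (fun u v => ∃ s t : Square m n, u = (s.1.val, s.2.val) ∧
        v = (t.1.val, t.2.val) ∧ l.idxOf t = l.idxOf s + 1) u v →
        ∃ s t : Square m n, u = (s.1.val, s.2.val) ∧
          v = (t.1.val, t.2.val) ∧ l.idxOf s < l.idxOf t := by
      intro u v huv
      induction huv with
      | single h1 =>
        obtain ⟨s, t, hs, ht, hst⟩ := h1
        exact ⟨s, t, hs, ht, by omega⟩
      | tail _ h1 ih =>
        obtain ⟨s, t, hs, ht, hst⟩ := ih
        obtain ⟨s', t', hs', ht', hst'⟩ := h1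
        have hts : t = s' := by
          rw [ht, Prod.mk.injEq] at hs'
          exact Prod.ext (Fin.ext hs'.1) (Fin.ext hs'.2)
        subst hts
        exact ⟨s, t', hs, ht', by omega⟩
    intro v hv
    obtain ⟨s, t, hs, ht, hst⟩ := key v v hv
    have : s = t := by
      rw [hs, Prod.mk.injEq] at ht
      exact Prod.ext (Fin.ext ht.1) (Fin.ext ht.2)
    subst this
    exact lt_irrefl _ hst

/-! ### Sufficiency: cutting a cyclic permutation open -/

section Orbit

variable {V : Type*} [Finite V] {f : V → V} {a b : V}

theorem exists_iterate_eq_of_orbit (hf : f.Injective) (hba : f b = a)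
    (hb : ∀ v, ∃ k, f^[k] v = b) (v : V) : ∃ k, f^[k] a = v := by
  obtain ⟨k, hk⟩ := hb v
  obtain ⟨q, hq, hper⟩ := hf.mem_periodicPts v
  have hka : f^[k + 1] v = a := by rw [Function.iterate_succ_apply', hk, hba]
  have hle : k + 1 ≤ q * (k + 1) := Nat.le_mul_of_pos_left _ hq
  -- The orbit of `v` reaches `a` after `k + 1` steps; continuing to a multiple of the period of `v`
  -- leads back to `v`.
  refine ⟨q * (k + 1) - (k + 1), ?_⟩
  rw [← hka, ← Function.iterate_add_apply, Nat.sub_add_cancel hle]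
  exact hper.mul_const (k + 1)

/-- A permutation with a single cycle is a hamiltonian path once one arrow is removed. -/
theorem exists_isHamiltonianPath {G : Digraph V} (hf : f.Injective) (hba : f b = a)
    (hadj : ∀ v, v ≠ b → G.Adj v (f v)) (hb : ∀ v, ∃ k, f^[k] v = b) :
    ∃ l, IsHamiltonianPath G a b l := by
  set P := Function.minimalPeriod f a with hP
  have hper : a ∈ Function.periodicPts f := hf.mem_periodicPts a
  have hpos : 0 < P := Function.minimalPeriod_pos_of_mem_periodicPts hper
  have hlast : f^[P - 1] a = b := by
    apply hf
    rw [hba, ← Function.iterate_succ_apply' f (P - 1) a, Nat.succ_eq_add_one,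
      Nat.sub_add_cancel hpos]
    exact Function.isPeriodicPt_minimalPeriod f a
  have hinj : ∀ s < P, ∀ t < P, f^[s] a = f^[t] a → s = t := by
    intro s hs t ht hst
    exact (Function.iterate_eq_iterate_iff_of_lt_minimalPeriod hs ht).1 hst
  refine ⟨(List.range P).map fun k => f^[k] a, ?_, ?_, ?_, ?_, ?_⟩
  · rw [List.isChain_iff_getElem]
    intro k hk
    simp only [List.length_map, List.length_range] at hk
    simp only [List.getElem_map, List.getElem_range, Function.iterate_succ_apply']
    refine hadj _ fun h => ?_
    have := hinj k (by omega) (P - 1) (by omega) (h.trans hlast.symm)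
    omega
  · exact List.Nodup.map_on (fun s hs t ht => hinj s (List.mem_range.1 hs) t (List.mem_range.1 ht))
      List.nodup_range
  · intro v
    obtain ⟨k, hk⟩ := exists_iterate_eq_of_orbit hf hba hb v
    exact List.mem_map.2 ⟨k % P, List.mem_range.2 (Nat.mod_lt _ hpos), by
      rw [Function.iterate_mod_minimalPeriod_eq, hk]⟩
  · rw [List.head?_map, List.head?_range, if_neg (by omega)]; rfl
  · rw [List.getLast?_map, List.getLast?_range, if_neg (by omega), Option.map_some, hlast]

end Orbit

/-- Only diagonal neighbours, matching ends of complementary levels, or a square with itself can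
collide. -/
theorem eastCoord_eq_northCoord {m n a b a' b' : ℕ} (ha : a < m) (hb : b < n) (ha' : a' < m)
    (hb' : b' < n) (h : eastCoord m n a b = northCoord m n a' b') :
    (a' = a + 1 ∧ b' + 1 = b) ∨ (a + b + a' + b' + 3 = m + n ∧ b = 0 ∧ b' + 1 = n) ∨
      (a + b + a' + b' + 3 = m + n ∧ a + 1 = m ∧ a' = 0) ∨ (a = a' ∧ b = b') := by
  unfold eastCoord northCoord at h
  split_ifs at h <;> rw [Prod.mk.injEq] at h <;> omega

/-- A rule `d` for travelling east yields a hamiltonian path if no square is entered twice,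
the initial square is not entered, and all squares lead to the terminal one. -/
theorem exists_path_of_rule {m n p : ℕ} {hp : p < m} {hn : 0 < n} {x : Fin m} {y : Fin n}
    (d : ℕ → ℕ → Prop)
    (hinj : ∀ a b a' b', a < m → b < n → a' < m → b' < n → ¬ (a = x ∧ b = y) →
      ¬ (a' = x ∧ b' = y) → d a b → ¬ d a' b' → eastCoord m n a b ≠ northCoord m n a' b')
    (heast : ∀ a b, a < m → b < n → ¬ (a = x ∧ b = y) → d a b → eastCoord m n a b ≠ (p, 0))
    (hnorth : ∀ a b, a < m → b < n → ¬ (a = x ∧ b = y) → ¬ d a b → northCoord m n a b ≠ (p, 0))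
    (hreach : ∀ R : ℕ × ℕ → ℕ × ℕ → Prop,
      (∀ a b, a < m → b < n → ¬ (a = x ∧ b = y) → d a b → R (a, b) (eastCoord m n a b)) →
      (∀ a b, a < m → b < n → ¬ (a = x ∧ b = y) → ¬ d a b → R (a, b) (northCoord m n a b)) →
      ∀ a b, a < m → b < n → ReflTransGen R (a, b) (x, y)) :
    ∃ l, IsHamiltonianPath (board m n) (⟨p, hp⟩, ⟨0, hn⟩) (x, y) l := by
  classical
  have hval : ∀ s t : Square m n, (s.1.val, s.2.val) = (t.1.val, t.2.val) → s = t := by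
    intro s t h
    rw [Prod.mk.injEq] at h
    exact Prod.ext (Fin.ext h.1) (Fin.ext h.2)
  have hE : ∀ s : Square m n, ((east s).1.val, (east s).2.val) = eastCoord m n s.1 s.2 := by
    intro s; unfold eastCoord east; split_ifs <;> rfl
  have hN : ∀ s : Square m n, ((north s).1.val, (north s).2.val) = northCoord m n s.1 s.2 := by
    intro s; unfold northCoord north; split_ifs <;> rfl
  have hne : ∀ s : Square m n, s ≠ (x, y) → ¬ (s.1.val = x.val ∧ s.2.val = y.val) :=
    fun s hs h => hs (Prod.ext (Fin.ext h.1) (Fin.ext h.2))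
  set ι : Square m n := (⟨p, hp⟩, ⟨0, hn⟩) with hι
  have hιE : ∀ s : Square m n, s ≠ (x, y) → d s.1 s.2 → east s ≠ ι := by
    intro s hs hd h
    refine heast s.1 s.2 s.1.2 s.2.2 (hne s hs) hd ?_
    rw [← hE, h]
  have hιN : ∀ s : Square m n, s ≠ (x, y) → ¬ d s.1 s.2 → north s ≠ ι := by
    intro s hs hd h
    refine hnorth s.1 s.2 s.1.2 s.2.2 (hne s hs) hd ?_
    rw [← hN, h]
  have hEN : ∀ s t : Square m n, s ≠ (x, y) → t ≠ (x, y) → d s.1 s.2 → ¬ d t.1 t.2 →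
      east s ≠ north t := by
    intro s t hs ht hds hdt h
    refine hinj s.1 s.2 t.1 t.2 s.1.2 s.2.2 t.1.2 t.2.2 (hne s hs) (hne t ht) hds hdt ?_
    rw [← hE, ← hN, h]
  have hEE : ∀ s t : Square m n, east s = east t → s = t := by
    intro s t h
    have h1 : eastCoord m n s.1 s.2 = eastCoord m n t.1 t.2 := by rw [← hE, ← hE, h]
    have := s.2.2
    have := t.2.2
    have := s.1.2
    have := t.1.2
    apply hval
    rw [Prod.mk.injEq]
    unfold eastCoord at h1
    split_ifs at h1 <;> rw [Prod.mk.injEq] at h1 <;> omega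
  have hNN : ∀ s t : Square m n, north s = north t → s = t := by
    intro s t h
    have h1 : northCoord m n s.1 s.2 = northCoord m n t.1 t.2 := by rw [← hN, ← hN, h]
    have := s.2.2
    have := t.2.2
    have := s.1.2
    have := t.1.2
    apply hval
    rw [Prod.mk.injEq]
    unfold northCoord at h1
    split_ifs at h1 <;> rw [Prod.mk.injEq] at h1 <;> omega
  let f : Square m n → Square m n := fun s =>
    if s = (x, y) then ι else if d s.1 s.2 then east s else north s
  have hfτ : f (x, y) = ι := if_pos rfl
  have hfE : ∀ s, s ≠ (x, y) → d s.1 s.2 → f s = east s := fun s hs hd => by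
    simp only [f, if_neg hs, if_pos hd]
  have hfN : ∀ s, s ≠ (x, y) → ¬ d s.1 s.2 → f s = north s := fun s hs hd => by
    simp only [f, if_neg hs, if_neg hd]
  have hfinj : f.Injective := by
    have hτ : ∀ s, f s = ι → s = (x, y) := by
      intro s h
      by_contra hs
      by_cases hd : d s.1 s.2
      · exact hιE s hs hd (hfE s hs hd ▸ h)
      · exact hιN s hs hd (hfN s hs hd ▸ h)
    intro s t h
    by_cases hs : s = (x, y)
    · rw [hs, hfτ] at h
      rw [hs, hτ t h.symm]
    by_cases ht : t = (x, y)
    · rw [ht, hfτ] at h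
      exact absurd (hτ s h) hs
    by_cases hds : d s.1 s.2 <;> by_cases hdt : d t.1 t.2
    · rw [hfE s hs hds, hfE t ht hdt] at h
      exact hEE s t h
    · rw [hfE s hs hds, hfN t ht hdt] at h
      exact absurd h (hEN s t hs ht hds hdt)
    · rw [hfN s hs hds, hfE t ht hdt] at h
      exact absurd h.symm (hEN t s ht hs hdt hds)
    · rw [hfN s hs hds, hfN t ht hdt] at h
      exact hNN s t h
  refine exists_isHamiltonianPath hfinj hfτ ?_ ?_
  · intro s hs
    by_cases hd : d s.1 s.2
    · exact Or.inl (hfE s hs hd)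
    · exact Or.inr (hfN s hs hd)
  · let S : ℕ × ℕ → ℕ × ℕ → Prop := fun u v => ∀ s : Square m n, u = (s.1.val, s.2.val) →
      v = ((f s).1.val, (f s).2.val)
    have key : ∀ u v, ReflTransGen S u v → ∀ s : Square m n, u = (s.1.val, s.2.val) →
        ∃ k, v = ((f^[k] s).1.val, (f^[k] s).2.val) := by
      intro u v huv s hs
      induction huv with
      | refl => exact ⟨0, hs⟩
      | tail _ h1 ih =>
        obtain ⟨k, hk⟩ := ih
        refine ⟨k + 1, ?_⟩
        rw [Function.iterate_succ_apply']
        exact h1 _ hk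
    intro s
    have hs := hreach S (fun a b ha hb hab hd t ht => ?_) (fun a b ha hb hab hd t ht => ?_)
      s.1 s.2 s.1.2 s.2.2
    · obtain ⟨k, hk⟩ := key _ _ hs s rfl
      exact ⟨k, (hval (x, y) _ hk).symm⟩
    · rw [Prod.mk.injEq] at ht
      obtain ⟨rfl, rfl⟩ := ht
      rw [hfE t (fun h => hab (by rw [h]; exact ⟨rfl, rfl⟩)) hd, hE]
    · rw [Prod.mk.injEq] at ht
      obtain ⟨rfl, rfl⟩ := ht
      rw [hfN t (fun h => hab (by rw [h]; exact ⟨rfl, rfl⟩)) hd, hN]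

/-! ### The flow with the central levels travelling north -/

/-- The levels travelling east if the `r` levels nearest to the middle travel north. -/
def eastRule (m n r s : ℕ) : Prop :=
  m + n ≤ 2 * s + r + 3 → 2 * s + 3 ≤ m + n + r → 2 * s + 3 = m + n ∧ r % 2 = 0

/-- All squares between the levels `s` and `t` lead to level `t`. -/
def Drains (m n s t : ℕ) (R : ℕ × ℕ → ℕ × ℕ → Prop) : Prop :=
  ∀ a b, a < m → b < n → s ≤ a + b → a + b < t → ∃ c < n, ReflTransGen R (a, b) (t - c, c)

namespace Flow

/-- `Crosses` only follows squares of the first level. The others must be kept from cycling too: a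
square stuck at the top of level `t` wraps to `(s + 1, 0)` and crosses again to height `r`, from
which a north step leaves level `t`. -/
theorem drains (h : Flow m n i j e R) {s t r r' : ℕ} (hst : s + t + 3 = m + n)
    (hi : i < s) (hlt : s < t) (hj : t < j) (hni : n ≤ i + 1)
    (hr : ¬ e s → r + 2 ≤ n) (hc : Crosses n (s + 1) t r R) (hd : Drains m n (s + 1) t R)
    (hc' : Crosses n s (t + 1) r' R) : Drains m n s (t + 1) R := by
  have htop : ∀ c < n, ∃ c' < n, ReflTransGen R (t - c, c) (t + 1 - c', c') := by
    intro c hcn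
    have hl : t - c + c = t := by omega
    by_cases he : e t
    · exact ⟨c, hcn, .single (h.east_step (by omega) hcn (by omega) (by omega) (hl.symm ▸ he)
        (by split_ifs <;> omega) (by split_ifs <;> omega))⟩
    have hup : ∀ c, c + 1 < n → R (t - c, c) (t + 1 - (c + 1), c + 1) := fun c hcn =>
      have hl : t - c + c = t := by omega
      h.north_step (by omega) (by omega) (by omega) (by omega) (hl.symm ▸ he)
        (by split_ifs; omega) (by split_ifs; omega)
    rcases Nat.lt_or_ge (c + 1) n with hcn' | hcn'
    · exact ⟨c + 1, hcn', .single (hup c hcn')⟩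
    have hrn := hr fun h' => he ((h.symm s t hst (by omega) (by omega)).1 h')
    have h0 := hc 0 (by omega)
    rw [turn_of_lt (b := 0) (by omega), Nat.zero_add] at h0
    exact ⟨r + 1, by omega, .head (h.north_step (by omega) hcn (by omega) (by omega)
      (hl.symm ▸ he) (by split_ifs <;> omega) (by split_ifs <;> omega))
      (.tail h0 (hup r (by omega)))⟩
  intro a b ha hb hs ht
  rcases eq_or_lt_of_le hs with hs | hs
  · have := hc' b hb
    rw [show s - b = a by omega] at this
    exact ⟨_, turn_lt hb, this⟩
  · have hmid : ∃ c < n, ReflTransGen R (a, b) (t - c, c) := by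
      rcases Nat.lt_or_ge (a + b) t with hlt | hge
      · exact hd a b ha hb hs hlt
      · exact ⟨b, hb, by rw [show t - b = a by omega]⟩
    obtain ⟨c, hcn, h1⟩ := hmid
    obtain ⟨c', hcn', h2⟩ := htop c hcn
    exact ⟨c', hcn', h1.trans h2⟩

/-- The shift counts the north levels among the `w` central ones. For odd `w` there is a middle
level, which travels east when `r` is even. -/
theorem crosses_eastRule {r : ℕ} (h : Flow m n i j (eastRule m n r) R)
    (hrn : r ≤ n) (hpar : (m + n) % 2 = 0 → r % 2 = 0) (hni : n ≤ i + 1) (hjm : j < m) :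
    ∀ w s t, w + s = t → s + t + 2 = m + n → i < s → t ≤ j →
      Crosses n s t (if w % 2 = 1 ∧ r % 2 = 0 then min r (w - 1) else min r w) R ∧
        Drains m n s t R := by
  intro w
  induction w using Nat.strong_induction_on with
  | _ w ih =>
  intro s t hw hst hi hj
  rcases Nat.lt_or_ge w 2 with h2 | h2
  · rcases Nat.lt_or_ge w 1 with h1 | h1
    · obtain rfl : s = t := by omega
      refine ⟨?_, fun a b ha hb hs ht => by omega⟩
      rw [show (if w % 2 = 1 ∧ r % 2 = 0 then min r (w - 1) else min r w) = 0 by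
        split_ifs <;> omega]
      exact Crosses.refl s
    · obtain rfl : t = s + 1 := by omega
      suffices hc : Crosses n s (s + 1)
          (if w % 2 = 1 ∧ r % 2 = 0 then min r (w - 1) else min r w) R by
        refine ⟨hc, fun a b ha hb hs ht => ?_⟩
        have := hc b hb
        rw [show s - b = a by omega] at this
        exact ⟨_, turn_lt hb, this⟩
      by_cases he : eastRule m n r s
      · rw [show (if w % 2 = 1 ∧ r % 2 = 0 then min r (w - 1) else min r w) = 0 by
          unfold eastRule at he; split_ifs <;> omega]
        exact h.crosses_middle_east (by omega) hi (by omega) hni he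
      · rw [show (if w % 2 = 1 ∧ r % 2 = 0 then min r (w - 1) else min r w) = 1 by
          unfold eastRule at he; split_ifs <;> omega]
        exact h.crosses_middle_north (by omega) hi (by omega) hni he
  · obtain ⟨t, rfl⟩ : ∃ t', t = t' + 1 := ⟨t - 1, by omega⟩
    obtain ⟨hc, hd⟩ := ih (w - 2) (by omega) (s + 1) t (by omega) (by omega) (by omega) (by omega)
    by_cases he : eastRule m n r s
    · rw [show (if (w - 2) % 2 = 1 ∧ r % 2 = 0 then min r (w - 2 - 1) else min r (w - 2)) =
          if w % 2 = 1 ∧ r % 2 = 0 then min r (w - 1) else min r w by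
        unfold eastRule at he; split_ifs <;> omega] at hc
      have hc' := h.crosses_east (by omega) hi (by omega) (by omega) hni hjm he hc
      exact ⟨hc', h.drains (by omega) hi (by omega) (by omega) hni (fun h' => absurd he h') hc hd
        hc'⟩
    · have hq : (if w % 2 = 1 ∧ r % 2 = 0 then min r (w - 1) else min r w) =
          (if (w - 2) % 2 = 1 ∧ r % 2 = 0 then min r (w - 2 - 1) else min r (w - 2)) + 2 := by
        unfold eastRule at he; split_ifs <;> omega
      have hq' : (if (w - 2) % 2 = 1 ∧ r % 2 = 0 then min r (w - 2 - 1) else min r (w - 2)) + 2 ≤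
          n := by rw [← hq]; split_ifs <;> omega
      have hc' := h.crosses_north (by omega) hi (by omega) (by omega) hni hjm he hq' hc
      rw [hq]
      exact ⟨hc', h.drains (by omega) hi (by omega) (by omega) hni (fun _ => hq') hc hd hc'⟩

theorem crosses_of_eastRule {r : ℕ} (h : Flow m n i j (eastRule m n r) R)
    (hij : i + j + 3 = m + n) (hr : r + i + 1 ≤ j)
    (hrn : r ≤ n) (hpar : (m + n) % 2 = 0 → r % 2 = 0) (hni : n ≤ i + 1) (hjm : j < m) :
    Crosses n (i + 1) j r R ∧ Drains m n (i + 1) j R := by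
  have := h.crosses_eastRule hrn hpar hni hjm (j - (i + 1)) (i + 1) j (by omega) (by omega)
    (by omega) le_rfl
  rwa [show (if (j - (i + 1)) % 2 = 1 ∧ r % 2 = 0 then min r (j - (i + 1) - 1)
    else min r (j - (i + 1))) = r by split_ifs <;> omega] at this

/-- If the terminal levels lead to the square `v` then all squares do. -/
theorem reaches_all (h : Flow m n i j e R) (hij : i + j + 3 = m + n) (hle : i ≤ j)
    (hni : n ≤ i + 1) (hlow : ∀ s < i, e s) (hd : Drains m n (i + 1) j R)
    {v : ℕ × ℕ} (hi : ∀ c < n, ReflTransGen R (i - c, c) v)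
    (hj : ∀ c < n, ReflTransGen R (j - c, c) v) :
    ∀ a b, a < m → b < n → ReflTransGen R (a, b) v := by
  have hbelow : ∀ w a b, a < m → b < n → a + b + w = i → ReflTransGen R (a, b) v := by
    intro w
    induction w with
    | zero =>
      intro a b ha hb hab
      have := hi b hb
      rwa [show i - b = a by omega] at this
    | succ w ih =>
      intro a b ha hb hab
      exact .head (h.east_step ha hb (by omega) (by omega) (hlow _ (by omega))
        (by rw [if_pos (by omega)]) (by rw [if_pos (by omega)]))
        (ih (a + 1) b (by omega) hb (by omega))
  intro a b ha hb
  rcases Nat.lt_or_ge i (a + b) with hlt | hge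
  · rcases lt_trichotomy (a + b) j with hj' | hj' | hj'
    · obtain ⟨c, hc, h1⟩ := hd a b ha hb hlt hj'
      exact h1.trans (hj c hc)
    · have := hj b hb
      rwa [show j - b = a by omega] at this
    · exact (h.half_turn hij hle (m + n - 2 - (a + b)) (by omega) a b ha hb
        (by omega)).to_reflTransGen.trans
        (hbelow (i - (m + n - 2 - (a + b))) _ _ (by omega) (by omega) (by omega))
  · exact hbelow (i - (a + b)) a b ha hb (by omega)

end Flow

/-! ### The direction rule on the whole board -/

theorem eastRule_symm {r s t : ℕ} (h : s + t + 3 = m + n) :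
    eastRule m n r s ↔ eastRule m n r t := by
  unfold eastRule; omega

/-- The direction rule with thresholds `α` and `β` on the terminal levels. -/
def rule (m n i j r α β a b : ℕ) : Prop :=
  (a + b = j → β ≤ b) ∧ (a + b = i → i ≠ j → α ≤ b) ∧
    (a + b ≠ j → a + b ≠ i → eastRule m n r (a + b))

theorem rule_high {r α β a b : ℕ} (h : a + b = j) : rule m n i j r α β a b ↔ β ≤ b := by
  unfold rule; omega

theorem rule_low {r α β a b : ℕ} (h : a + b = i) (hij : i ≠ j) :
    rule m n i j r α β a b ↔ α ≤ b := by
  unfold rule; omega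

theorem rule_other {r α β a b : ℕ} (h : a + b ≠ i) (h' : a + b ≠ j) :
    rule m n i j r α β a b ↔ eastRule m n r (a + b) := by
  unfold rule
  exact ⟨fun h1 => h1.2.2 h' h, fun h1 =>
    ⟨fun h2 => absurd h2 h', fun h2 => absurd h2 h, fun _ _ => h1⟩⟩

theorem flow_rule {r α β x y : ℕ} (hxy : x + y = i ∨ x + y = j)
    (hE : ∀ a b, a < m → b < n → ¬ (a = x ∧ b = y) → rule m n i j r α β a b →
      R (a, b) (eastCoord m n a b))
    (hN : ∀ a b, a < m → b < n → ¬ (a = x ∧ b = y) → ¬ rule m n i j r α β a b →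
      R (a, b) (northCoord m n a b)) : Flow m n i j (eastRule m n r) R where
  east a b ha hb hi hj he := hE a b ha hb (by omega) ((rule_other hi hj).2 he)
  north a b ha hb hi hj he := hN a b ha hb (by omega) (mt (rule_other hi hj).1 he)
  symm s t hst _ _ := eastRule_symm hst

/-- In `hτ`, `α = 0` makes level `i` travel east and `β = n` makes level `j` travel north. The
terminal square falls below its threshold, but its own direction is never used. -/
theorem rule_inj {r α β x y : ℕ} (hij : i + j + 3 = m + n) (hle : i ≤ j) (hni : n ≤ i + 1)
    (hy : y < n)
    (hτ : (x + y = j ∧ α = 0 ∧ β = y + 1) ∨ (x + y = i ∧ i < j ∧ α = y + 1 ∧ β = n))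
    {a b a' b' : ℕ} (ha : a < m) (hb : b < n) (ha' : a' < m) (hb' : b' < n)
    (hab : ¬ (a = x ∧ b = y)) (hab' : ¬ (a' = x ∧ b' = y))
    (hd : rule m n i j r α β a b) (hd' : ¬ rule m n i j r α β a' b') :
    eastCoord m n a b ≠ northCoord m n a' b' := by
  intro heq
  have hc := eastCoord_eq_northCoord ha hb ha' hb' heq
  by_cases hsame : a = a' ∧ b = b'
  · rw [hsame.1, hsame.2] at hd
    exact hd' hd
  by_cases hj : a + b = j
  · rw [rule_high hj] at hd
    by_cases hj' : a' + b' = j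
    · rw [rule_high hj'] at hd'
      omega
    · rw [rule_low (by omega) (by omega)] at hd'
      omega
  by_cases hi : a + b = i
  · rw [rule_low hi (by omega)] at hd
    by_cases hj' : a' + b' = j
    · rw [rule_high hj'] at hd'
      omega
    · rw [rule_low (by omega) (by omega)] at hd'
      omega
  · rw [rule_other hi hj] at hd
    rw [rule_other (by omega) (by omega)] at hd'
    rcases (by omega : a' + b' = a + b ∨ a + b + (a' + b') + 3 = m + n) with h | h
    · rw [h] at hd'
      exact hd' hd
    · exact hd' ((eastRule_symm h).1 hd)

theorem rule_east_ne {r α β x y : ℕ} (hn : 1 ≤ n)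
    (hτ : (x + y = j ∧ α = 0 ∧ β = y + 1) ∨ (x + y = i ∧ i < j ∧ α = y + 1 ∧ β = n))
    {a b : ℕ} (hab : ¬ (a = x ∧ b = y)) (hd : rule m n i j r α β a b) :
    eastCoord m n a b ≠ (j + 1, 0) := by
  intro h
  unfold eastCoord at h
  split_ifs at h <;> rw [Prod.mk.injEq] at h
  · rw [rule_high (by omega)] at hd
    omega
  · omega

theorem rule_north_ne {r α β x y : ℕ} (hij : i + j + 3 = m + n) (hle : i ≤ j)
    (hτ : (x + y = j ∧ α = 0 ∧ β = y + 1) ∨ (x + y = i ∧ i < j ∧ α = y + 1 ∧ β = n))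
    {a b : ℕ} (ha : a < m) (hb : b < n) (hy : y < n) (hab : ¬ (a = x ∧ b = y))
    (hd : ¬ rule m n i j r α β a b) : northCoord m n a b ≠ (j + 1, 0) := by
  intro h
  unfold northCoord at h
  split_ifs at h <;> rw [Prod.mk.injEq] at h
  · omega
  · rcases eq_or_lt_of_le hle with hlt | hlt
    · rw [rule_high (by omega)] at hd
      omega
    · rw [rule_low (by omega) (by omega)] at hd
      omega

/-- With the terminal square in the correct place, every square leads to it. -/
theorem rule_reach {r α β x y : ℕ} (hn : 1 ≤ n) (hij : i + j + 3 = m + n) (hle : i ≤ j)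
    (hni : n ≤ i + 1) (hjm : j + 1 < m) (hy : y < n) (hrn : r ≤ n)
    (hr : (r = 0 ∧ i = j) ∨ r + i + 1 ≤ j) (hpar : (m + n) % 2 = 0 → r % 2 = 0)
    (hτ : (x + y = j ∧ α = 0 ∧ β = y + 1 ∧ y = (n + r - 1) / 2) ∨
      (x + y = i ∧ i < j ∧ α = y + 1 ∧ β = n ∧ r + 2 ≤ n ∧ y = (n - 2 - r) / 2))
    (hE : ∀ a b, a < m → b < n → ¬ (a = x ∧ b = y) → rule m n i j r α β a b →
      R (a, b) (eastCoord m n a b))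
    (hN : ∀ a b, a < m → b < n → ¬ (a = x ∧ b = y) → ¬ rule m n i j r α β a b →
      R (a, b) (northCoord m n a b)) :
    ∀ a b, a < m → b < n → ReflTransGen R (a, b) (x, y) := by
  have hF := flow_rule (r := r) (α := α) (β := β) (x := x) (y := y) (by omega) hE hN
  have hturn := hF.half_turn hij hle i le_rfl
  have htrans : ∀ u v w, TransGen R (i - u, u) (i - v, v) → TransGen R (i - v, v) (i - w, w) →
      TransGen R (i - u, u) (i - w, w) := fun u v w => TransGen.trans
  have hlow : ∀ s < i, eastRule m n r s := fun s hs => by unfold eastRule; omega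
  have hjE : ∀ c < n, ¬ (j = x + y ∧ c = y) → β ≤ c → R (j - c, c) (j + 1 - c, c) := by
    intro c hc hne h
    have h1 := hE (j - c) c (by omega) hc (by omega) ((rule_high (by omega)).2 h)
    rwa [eastCoord_of_lt (by omega), show j - c + 1 = j + 1 - c by omega] at h1
  have hjN : ∀ c, c + 1 < n → ¬ (j = x + y ∧ c = y) → c < β → R (j - c, c) (j - c, c + 1) := by
    intro c hc hne h
    have h1 := hN (j - c) c (by omega) (by omega) (by omega)
      (fun h' => by rw [rule_high (by omega)] at h'; omega)
    rwa [northCoord_of_lt (by omega)] at h1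
  have hiE : i < j → ∀ c < n, ¬ (i = x + y ∧ c = y) → α ≤ c → R (i - c, c) (i + 1 - c, c) := by
    intro hlt c hc hne h
    have h1 := hE (i - c) c (by omega) hc (by omega) ((rule_low (by omega) (by omega)).2 h)
    rwa [eastCoord_of_lt (by omega), show i - c + 1 = i + 1 - c by omega] at h1
  have hiN : i < j → ∀ c, c + 1 < n → ¬ (i = x + y ∧ c = y) → c < α →
      R (i - c, c) (i - c, c + 1) := by
    intro hlt c hc hne h
    have h1 := hN (i - c) c (by omega) (by omega) (by omega)
      (fun h' => by rw [rule_low (by omega) (by omega)] at h'; omega)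
    rwa [northCoord_of_lt (by omega)] at h1
  have hcross : i < j → Crosses n (i + 1) j r R ∧ Drains m n (i + 1) j R := fun hlt =>
    hF.crosses_of_eastRule hij (by omega) hrn hpar hni (by omega)
  have hdrain : Drains m n (i + 1) j R := by
    rcases eq_or_lt_of_le hle with hlt | hlt
    · exact fun a b ha hb hs ht => by omega
    · exact (hcross hlt).2
  have heast : ∀ c < n, TransGen R (j + 1 - c, c) (i - (n - 1 - c), n - 1 - c) := by
    intro c hc
    have h1 := hturn (j + 1 - c) c (by omega) hc (by omega)
    rwa [show m - 1 - (j + 1 - c) = i - (n - 1 - c) by omega] at h1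
  have hnorth : ∀ c, c + 1 < n → TransGen R (j - c, c + 1) (i - (n - 2 - c), n - 2 - c) := by
    intro c hc
    have h1 := heast (c + 1) hc
    rwa [show j + 1 - (c + 1) = j - c by omega, show n - 1 - (c + 1) = n - 2 - c by omega] at h1
  rcases hτ with ⟨hxy, rfl, rfl, hk⟩ | ⟨hxy, hlt, rfl, hβ, hrn2, hk⟩
  · have hgt : ∀ c < n, y < c → R (j - c, c) (j + 1 - c, c) :=
      fun c hc h => hjE c hc (by omega) h
    have hlt : ∀ c < y, R (j - c, c) (j - c, c + 1) :=
      fun c h => hjN c (by omega) (by omega) (by omega)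
    have hc : Crosses n i j r R := by
      rcases eq_or_lt_of_le hle with rfl | hlt
      · obtain rfl : r = 0 := by omega
        exact Crosses.refl i
      · exact fun b hb => .head (hiE hlt b hb (by omega) (by omega)) ((hcross hlt).1 b hb)
    obtain ⟨h1, h2⟩ := late_return hij hni hturn hjm hc hgt hlt hy hle
    -- With the end on level `j`, the target on level `i` is the height whose crossing lands on the
    -- end.
    obtain ⟨u₀, hu₀, htu, hreach⟩ := late_reach
      (G := fun u v => TransGen R (i - u, u) (i - v, v)) htrans hn hrn hk h1 h2
    have hfin := hc u₀ hu₀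
    rw [htu, show j - y = x by omega] at hfin
    have hi : ∀ c < n, ReflTransGen R (i - c, c) (x, y) := by
      intro c hcn
      rcases hreach c hcn with rfl | h3
      · exact hfin
      · exact h3.to_reflTransGen.trans hfin
    refine hF.reaches_all hij hle hni hlow hdrain hi fun c hcn => ?_
    rcases lt_trichotomy c y with h | rfl | h
    · exact .head (hlt c h) ((hnorth c (by omega)).to_reflTransGen.trans (hi _ (by omega)))
    · rw [show j - c = x by omega]
    · exact .head (hgt c hcn h) ((heast c hcn).to_reflTransGen.trans (hi _ (by omega)))
  · obtain ⟨hc, -⟩ := hcross hlt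
    have hj : ∀ c, c + 1 < n → R (j - c, c) (j - c, c + 1) :=
      fun c h => hjN c h (by omega) (by omega)
    have hjtop : R (j - (n - 1), n - 1) (i + 1, 0) := by
      have h1 := hN (j - (n - 1)) (n - 1) (by omega) (by omega) (by omega)
        (fun h' => by rw [rule_high (by omega)] at h'; omega)
      rwa [northCoord_of_eq (by omega), show m - 1 - (j - (n - 1)) = i + 1 by omega] at h1
    obtain ⟨-, h1, h2⟩ := early_return hij hni hturn hjm hlt hc
      (fun c hc h => hiE hlt c hc (by omega) h)
      (fun c h => hiN hlt c (by omega) (by omega) (by omega)) hy hj hjtop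
    have hreach := early_reach (G := fun u v => TransGen R (i - u, u) (i - v, v)) htrans hrn2 hk
      h1 (h2 hrn2)
    have hi : ∀ c < n, ReflTransGen R (i - c, c) (x, y) := by
      intro c hcn
      have hx : i - y = x := by omega
      rcases hreach c hcn with rfl | h3
      · rw [hx]
      · rw [hx] at h3
        exact h3.to_reflTransGen
    have hup : ∀ c, c + 1 < n → ReflTransGen R (j - c, c) (x, y) := fun c hcn =>
      .head (hj c hcn) ((hnorth c hcn).to_reflTransGen.trans (hi _ (by omega)))
    refine hF.reaches_all hij hle hni hlow hdrain hi fun c hcn => ?_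
    rcases Nat.lt_or_ge (c + 1) n with h | h
    · exact hup c h
    · have h0 := hc 0 (by omega)
      rw [turn_of_lt (b := 0) (by omega), Nat.zero_add] at h0
      rw [show c = n - 1 by omega]
      exact .head hjtop (h0.trans (hup r (by omega)))

theorem exists_path_of_turn {p : ℕ} (r : ℕ) {hpm : p < m} {hn : 0 < n} {x : Fin m} {y : Fin n}
    (hp : p = j + 1) (hij : i + j + 3 = m + n) (hle : i ≤ j) (hni : n ≤ i + 1) (hrn : r ≤ n)
    (hr : (r = 0 ∧ i = j) ∨ r + i + 1 ≤ j) (hpar : (m + n) % 2 = 0 → r % 2 = 0)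
    (hτ : (x.val + y.val = j ∧ y.val = (n + r - 1) / 2) ∨
      (x.val + y.val = i ∧ i < j ∧ r + 2 ≤ n ∧ y.val = (n - 2 - r) / 2)) :
    ∃ l, IsHamiltonianPath (board m n) (⟨p, hpm⟩, ⟨0, hn⟩) (x, y) l := by
  subst hp
  obtain ⟨α, β, hαβ⟩ : ∃ α β : ℕ,
      (x.val + y.val = j ∧ α = 0 ∧ β = y.val + 1 ∧ y.val = (n + r - 1) / 2) ∨
      (x.val + y.val = i ∧ i < j ∧ α = y.val + 1 ∧ β = n ∧ r + 2 ≤ n ∧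
        y.val = (n - 2 - r) / 2) := by
    rcases hτ with h | h
    · exact ⟨0, y.val + 1, Or.inl ⟨h.1, rfl, rfl, h.2⟩⟩
    · exact ⟨y.val + 1, n, Or.inr ⟨h.1, h.2.1, rfl, rfl, h.2.2⟩⟩
  have hαβ' : (x.val + y.val = j ∧ α = 0 ∧ β = y.val + 1) ∨
      (x.val + y.val = i ∧ i < j ∧ α = y.val + 1 ∧ β = n) := by omega
  exact exists_path_of_rule (rule m n i j r α β)
    (fun a b a' b' ha hb ha' hb' hab hab' hd hd' =>
      rule_inj hij hle hni y.2 hαβ' ha hb ha' hb' hab hab' hd hd')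
    (fun a b ha hb hab hd => rule_east_ne hn hαβ' hab hd)
    (fun a b ha hb hab hd => rule_north_ne hij hle hαβ' ha hb y.2 hab hd)
    (fun R hE hN => rule_reach hn hij hle hni hpm y.2 hrn hr hpar hαβ hE hN)

end ProjectiveCheckerboard

theorem mainTheorem4 (m n p : ℕ) (hn : 3 ≤ n) (hmn : n < m)
    (hp : (m + n) / 2 ≤ p) (hpm : p ≤ m - 1) (x : Fin m) (y : Fin n) :
    (∃ l : List (ProjectiveCheckerboard.Square m n),
      ProjectiveCheckerboard.IsHamiltonianPath (ProjectiveCheckerboard.board m n)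
        (⟨p, by omega⟩, ⟨0, by omega⟩) (x, y) l) ↔
    ((x.val + y.val = m + n - p - 2 ∧
        m - p + (n - 1) / 2 ≤ x.val ∧ x.val ≤ (m - 1) / 2 ∧ 2 * p ≠ m + n - 1) ∨
      (x.val + y.val = p - 1 ∧ m / 2 ≤ x.val ∧ x.val ≤ p - (n + 1) / 2) ∨
      (x.val = (m - 1) / 2 ∧ y.val = (n - 1) / 2 ∧ 2 * p = m + n - 1)) := by
  constructor
  · rintro ⟨l, hl⟩
    exact hl.trail.terminal hn hmn hp hpm x.2 y.2
  · intro h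
    have hx := x.2
    have hy := y.2
    by_cases hlow : x.val + y.val + 1 = p
    -- Up to two values of `r` solve `y = (n + r - 1) / 2`. The smaller one keeps `r` within `j - i
    -- - 1`, except that `r` must be even when `m` and `n` both are. Truncated subtraction gives `r
    -- = 0` when `2 * y + 1 < n`.
    · refine ProjectiveCheckerboard.exists_path_of_turn (i := m + n - 2 - p) (j := p - 1)
        (if m % 2 = 0 ∧ n % 2 = 0 then 2 * y.val + 2 - n else 2 * y.val + 1 - n)
        (by omega) (by omega) (by omega) (by omega) ?_ ?_ ?_ (Or.inl ⟨by omega, ?_⟩) <;>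
      split_ifs <;> omega
    -- Likewise for `y = (n - 2 - r) / 2`: the parity of `m` decides which solution respects `r ≤ j
    -- - i - 1`, given the upper bound on `x`.
    · refine ProjectiveCheckerboard.exists_path_of_turn (i := m + n - 2 - p) (j := p - 1)
        (if m % 2 = 1 then n - 3 - 2 * y.val else n - 2 - 2 * y.val)
        (by omega) (by omega) (by omega) (by omega) ?_ ?_ ?_
        (Or.inr ⟨by omega, by omega, ?_, ?_⟩) <;>
      split_ifs <;> omega
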